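/- Let $\mu$ be a measure on a measurable space $(\Omega,\mathcal F)$ and let $\mathcal P_0,\mathcal P_1$ be convex sets of probability measures on $(\Omega,\mathcal F)$, all of which have densities with respect to $\mu$; write $p_i$ and $q_i$ for the ($[0,\infty)$-valued) densities of $P_i$ and $Q_i$. For $\lambda\ge 0$ put $$L_\lambda(P_0,P_1)=\int \min\{p_0,\lambda p_1\}\,\mathrm d\mu .$$ If a pair $(Q_0,Q_1)\in\mathcal P_0\times\mathcal P_1$ maximizes $L_\lambda$ over $\mathcal P_0\times\mathcal P_1$ simultaneously for every $\lambda\ge 0$, then $(Q_0,Q_1)$ is least favorable in the sense of stochastic dominance, that is, $$Q_0\Big[\tfrac{q_1}{q_0}>\eta\Big]\ \ge\ P_0\Big[\tfrac{q_1}{q_0}>\eta\Big]\quad\text{and}\quad Q_1\Big[\tfrac{q_1}{q_0}\le\eta\Big]\ \ge\ P_1\Big[\tfrac{q_1}{q_0}\le\eta\Big]$$ for all $(P_0,P_1)\in\mathcal P_0\times\mathcal P_1$ and all $\eta\ge 0$. Here $q_1/q_0=\infty$ where $q_0=0<q_1$, and points with $q_0=q_1=0$, where the ratio is undefined, belong to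 neither event. -/

import Mathlib

open MeasureTheory
open scoped NNReal ENNReal

namespace RobustTest

variable {Ω : Type*} [MeasurableSpace Ω]

/-- `p` is a (version of the) density of `P` with respect to `μ`: a nonnegative, real-valued,
measurable function with `P B = ∫_B p dμ` for all measurable `B`. -/
def HasDensity (μ P : Measure Ω) (p : Ω → ℝ≥0) : Prop :=
  Measurable p ∧ P = μ.withDensity (fun x => (p x : ℝ≥0∞))

/-- The set of all probability measures that have a density with respect to `μ`. -/
def DominatedDistributions (μ : Measure Ω) : Set (Measure Ω) :=
  {P | IsProbabilityMeasure P ∧ ∃ p : Ω → ℝ≥0, HasDensity μ P p}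

/-- `L_l = ∫ min {p₀, l p₁} dμ`, as a function of the densities `p₀, p₁`. For densities of
probability measures the value is at most `1`, and it is the same for all versions of the
densities. -/
noncomputable def L (μ : Measure Ω) (l : ℝ≥0) (p₀ p₁ : Ω → ℝ≥0) : ℝ≥0∞ :=
  ∫⁻ x, ((min (p₀ x) (l * p₁ x) : ℝ≥0) : ℝ≥0∞) ∂μ

/-- The pair with densities `q₀, q₁` maximizes `L_l` over `𝒫₀ × 𝒫₁`, for every `l ≥ 0`. -/
def MaximizesL (μ : Measure Ω) (𝒫₀ 𝒫₁ : Set (Measure Ω)) (q₀ q₁ : Ω → ℝ≥0) : Prop :=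
  ∀ l : ℝ≥0, ∀ P₀ ∈ 𝒫₀, ∀ P₁ ∈ 𝒫₁, ∀ p₀ p₁ : Ω → ℝ≥0,
    HasDensity μ P₀ p₀ → HasDensity μ P₁ p₁ → L μ l p₀ p₁ ≤ L μ l q₀ q₁

/-- The set on which the likelihood ratio `q₁ / q₀ ∈ [0, ∞]` is defined, i.e. is not `0 / 0`. -/
def ratioDomain (q₀ q₁ : Ω → ℝ≥0) : Set Ω := {x | ¬ (q₀ x = 0 ∧ q₁ x = 0)}

/-- The likelihood ratio `q₁ / q₀`, equal to `∞` where `q₀ = 0 < q₁`; its value matters only on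
`ratioDomain q₀ q₁`. -/
noncomputable def ratio (q₀ q₁ : Ω → ℝ≥0) (x : Ω) : ℝ≥0∞ := (q₁ x : ℝ≥0∞) / (q₀ x : ℝ≥0∞)

/-- The event `{q₁ / q₀ > η}`. -/
def ratioGT (q₀ q₁ : Ω → ℝ≥0) (η : ℝ≥0) : Set Ω :=
  {x ∈ ratioDomain q₀ q₁ | (η : ℝ≥0∞) < ratio q₀ q₁ x}

/-- The event `{q₁ / q₀ ≤ η}`. -/
def ratioLE (q₀ q₁ : Ω → ℝ≥0) (η : ℝ≥0) : Set Ω :=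
  {x ∈ ratioDomain q₀ q₁ | ratio q₀ q₁ x ≤ (η : ℝ≥0∞)}

/-- The pair `(Q₀, Q₁)`, with densities `q₀, q₁`, is least favorable for `(𝒫₀, 𝒫₁)` in the sense of
stochastic dominance: it jointly maximizes both error probabilities of the single-sample test that
compares the likelihood ratio `q₁ / q₀` with `η`, for every threshold `η ≥ 0`. -/
def StochasticallyLeastFavorable (𝒫₀ 𝒫₁ : Set (Measure Ω)) (Q₀ Q₁ : Measure Ω)
    (q₀ q₁ : Ω → ℝ≥0) : Prop :=
  ∀ P₀ ∈ 𝒫₀, ∀ P₁ ∈ 𝒫₁, ∀ η : ℝ≥0,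
    P₀ (ratioGT q₀ q₁ η) ≤ Q₀ (ratioGT q₀ q₁ η) ∧
    P₁ (ratioLE q₀ q₁ η) ≤ Q₁ (ratioLE q₀ q₁ η)

end RobustTest

namespace RobustTest

open Filter Topology

variable {Ω : Type*}

/-! This is a first-order optimality argument. Fix one density of the maximizing pair and move the
other, `a`, to `s * a + t * b` with `s + t = 1`, which convexity allows. The integral of `min {·,
c}` cannot increase, and letting `t → 0` gives `∫_{a<c} b ≤ ∫_{a≤c} a`
(`withDensity_lt_le_withDensity_le`). A pointwise inequality with explicit error sets
(`min_add_indicator_le`) replaces differentiation under the integral. With `λ = 1/η` this nearly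
gives both claims, but with a strict inequality on one side and a weak one on the other. Thresholds
decreasing strictly to `η` remove the mismatch and also cover `η = 0`; the 0/0 points are null under
`Q₀` and `Q₁`. -/

lemma mem_ratioGT {q₀ q₁ : Ω → ℝ≥0} {η : ℝ≥0} {x : Ω} :
    x ∈ ratioGT q₀ q₁ η ↔ η * q₀ x < q₁ x := by
  simp only [ratioGT, ratioDomain, ratio, Set.mem_ofPred_eq]
  rcases eq_or_ne (q₀ x) 0 with h | h
  · rcases eq_or_ne (q₁ x) 0 with h1 | h1
    · simp [h, h1]
    · simp [h, h1, ENNReal.div_zero, pos_iff_ne_zero]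
  · rw [← ENNReal.coe_div h, ENNReal.coe_lt_coe, lt_div_iff₀ (pos_iff_ne_zero.2 h)]
    simp [h]

lemma mem_ratioLE {q₀ q₁ : Ω → ℝ≥0} {η : ℝ≥0} {x : Ω} :
    x ∈ ratioLE q₀ q₁ η ↔ q₀ x ≠ 0 ∧ q₁ x ≤ η * q₀ x := by
  simp only [ratioLE, ratioDomain, ratio, Set.mem_ofPred_eq]
  rcases eq_or_ne (q₀ x) 0 with h | h
  · rcases eq_or_ne (q₁ x) 0 with h1 | h1
    · simp [h, h1]
    · simp [h, h1, ENNReal.div_zero]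
  · rw [← ENNReal.coe_div h, ENNReal.coe_le_coe, div_le_iff₀ (pos_iff_ne_zero.2 h)]
    simp [h]

/-- The first-order gain of moving from `a` towards `b` under truncation at `c`. -/
lemma min_add_indicator_le (a b c s t : ℝ≥0) (hst : s + t = 1) :
    min a c + t * (if s * a + t * b ≤ c ∧ a < c then b else 0) ≤
      min (s * a + t * b) c + t * (if s * a ≤ c then a else 0) := by
  have ha : s * a + t * a = a := by rw [← add_mul, hst, one_mul]
  have hsa : s * a ≤ a := le_of_le_of_eq le_self_add ha
  rcases le_or_gt (s * a) c with h | h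
  · rw [if_pos h]
    split_ifs with h1
    · rw [min_eq_left h1.1, min_eq_left h1.2.le]
      refine le_of_eq ?_
      nth_rewrite 1 [← ha]
      ring
    · rw [mul_zero, add_zero]
      rcases le_total (s * a + t * b) c with h2 | h2
      · rw [min_eq_left h2]
        refine (min_le_left a c).trans ?_
        nth_rewrite 1 [← ha]
        gcongr
        exact le_self_add
      · rw [min_eq_right h2]
        exact (min_le_right a c).trans le_self_add
  · rw [if_neg h.not_ge, if_neg fun h1 => (h.trans_le hsa).not_gt h1.2]
    simp only [mul_zero, add_zero]
    rw [min_eq_right (h.trans_le le_self_add).le]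
    exact min_le_right a c

/-- The sequence `1 / (n + 2)` of step lengths. -/
noncomputable def step (n : ℕ) : ℝ≥0 := ((n : ℝ≥0) + 2)⁻¹

lemma step_pos (n : ℕ) : 0 < step n := by
  unfold step; positivity

lemma step_le_one (n : ℕ) : step n ≤ 1 :=
  inv_le_one_of_one_le₀ (one_le_two.trans le_add_self)

lemma antitone_step : Antitone step := fun m n h => by
  unfold step
  gcongr

lemma tendsto_step : Tendsto step atTop (𝓝 0) := by
  rw [← NNReal.tendsto_coe]
  have h : Tendsto (fun n : ℕ => ((n : ℝ) + 2)⁻¹) atTop (𝓝 0) :=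
    tendsto_inv_atTop_zero.comp (tendsto_atTop_add_const_right _ _ tendsto_natCast_atTop_atTop)
  simpa [step] using h

/-- A shorter step from `a` towards `b` ends between `a` and the endpoint of the longer step, and
both of these are at most `c`. -/
lemma add_mul_le_of_le {a b c s t s' t' : ℝ≥0} (hst : s + t = 1) (hst' : s' + t' = 1)
    (ht : t' ≤ t) (h : s * a + t * b ≤ c) (hac : a ≤ c) : s' * a + t' * b ≤ c := by
  have e1 : (s : ℝ) = 1 - t := by rw [eq_sub_iff_add_eq]; exact_mod_cast hst
  have e2 : (s' : ℝ) = 1 - t' := by rw [eq_sub_iff_add_eq]; exact_mod_cast hst'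
  rw [← NNReal.coe_le_coe] at h hac ht ⊢
  push_cast at h ⊢
  rw [e1] at h
  rw [e2]
  rcases le_total (b : ℝ) a with hb | hb
  · nlinarith [mul_nonneg t'.coe_nonneg (sub_nonneg.2 hb)]
  · nlinarith [mul_nonneg (sub_nonneg.2 ht) (sub_nonneg.2 hb)]

variable [MeasurableSpace Ω]

/-- If moving from `a` towards `b` never increases `∫ min {·, c}`, then `b` has no more mass on
`{a < c}` than `a` has on `{a ≤ c}`. -/
lemma withDensity_lt_le_withDensity_le {μ : Measure Ω} {a b c : Ω → ℝ≥0} (ha : Measurable a)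
    (hb : Measurable b) (hc : Measurable c) (hfin : ∫⁻ x, a x ∂μ ≠ ∞)
    (hopt : ∀ s t : ℝ≥0, s + t = 1 →
      ∫⁻ x, (min (s * a x + t * b x) (c x) : ℝ≥0) ∂μ ≤ ∫⁻ x, (min (a x) (c x) : ℝ≥0) ∂μ) :
    μ.withDensity (fun x => b x) {x | a x < c x} ≤
      μ.withDensity (fun x => a x) {x | a x ≤ c x} := by
  set σ : ℕ → ℝ≥0 := fun n => 1 - step n with hσ
  have hσt : ∀ n, σ n + step n = 1 := fun n => tsub_add_cancel_of_le (step_le_one n)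
  have hσlim : Tendsto σ atTop (𝓝 1) := by
    simpa using (tendsto_const_nhds (x := (1 : ℝ≥0))).sub tendsto_step
  set S : ℕ → Set Ω := fun n => {x | σ n * a x + step n * b x ≤ c x ∧ a x < c x}
  set T : ℕ → Set Ω := fun n => {x | σ n * a x ≤ c x}
  have hS : ∀ n, MeasurableSet (S n) := fun n =>
    (measurableSet_le ((ha.const_mul _).add (hb.const_mul _)) hc).inter
      (measurableSet_lt ha hc : MeasurableSet {x | a x < c x})
  have hT : ∀ n, MeasurableSet (T n) := fun n => measurableSet_le (ha.const_mul _) hc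
  have hminfin : ∫⁻ x, (min (a x) (c x) : ℝ≥0) ∂μ ≠ ∞ :=
    ne_top_of_le_ne_top hfin (lintegral_mono fun x => ENNReal.coe_le_coe.2 (min_le_left _ _))
  have key : ∀ n, μ.withDensity (fun x => (b x : ℝ≥0∞)) (S n) ≤
      μ.withDensity (fun x => (a x : ℝ≥0∞)) (T n) := fun n => by
    rw [withDensity_apply _ (hS n), withDensity_apply _ (hT n), ← lintegral_indicator (hS n),
      ← lintegral_indicator (hT n)]
    have hb' : Measurable fun x => (b x : ℝ≥0∞) := hb.coe_nnreal_ennreal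
    have ha' : Measurable fun x => (a x : ℝ≥0∞) := ha.coe_nnreal_ennreal
    have hle : ∫⁻ x, ((min (a x) (c x) : ℝ≥0) : ℝ≥0∞) +
          step n * (S n).indicator (fun x => (b x : ℝ≥0∞)) x ∂μ ≤
        ∫⁻ x, ((min (σ n * a x + step n * b x) (c x) : ℝ≥0) : ℝ≥0∞) +
          step n * (T n).indicator (fun x => (a x : ℝ≥0∞)) x ∂μ := by
      refine lintegral_mono fun x => ?_
      have := min_add_indicator_le (a x) (b x) (c x) (σ n) (step n) (hσt n)
      rw [← ENNReal.coe_le_coe] at this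
      simp only [Set.indicator_apply, S, T, Set.mem_ofPred_eq]
      split_ifs at this ⊢ <;> exact_mod_cast this
    rw [lintegral_add_left (ha.min hc).coe_nnreal_ennreal,
      lintegral_add_right _ ((ha'.indicator (hT n)).const_mul _),
      lintegral_const_mul _ (hb'.indicator (hS n)),
      lintegral_const_mul _ (ha'.indicator (hT n))] at hle
    -- Optimality bounds the moved integral by the one at `a`. That finite term cancels, leaving a
    -- common factor `step n`.
    have hle' := (ENNReal.add_le_add_iff_left hminfin).1
      (hle.trans (add_le_add_left (hopt _ _ (hσt n)) _))
    exact (ENNReal.mul_le_mul_iff_right (ENNReal.coe_ne_zero.2 (step_pos n).ne')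
      ENNReal.coe_ne_top).1 hle'
  have hSmono : Monotone S := fun m n hmn x hx =>
    ⟨add_mul_le_of_le (hσt m) (hσt n) (antitone_step hmn) hx.1 hx.2.le, hx.2⟩
  have hTanti : Antitone T := fun m n hmn x hx =>
    (mul_le_mul_left (tsub_le_tsub_left (antitone_step hmn) 1) (a x)).trans hx
  have hSU : ⋃ n, S n = {x | a x < c x} := by
    ext x
    simp only [Set.mem_iUnion, S, Set.mem_ofPred_eq]
    refine ⟨fun ⟨n, hn⟩ => hn.2, fun hx => ?_⟩
    have hlim : Tendsto (fun n => σ n * a x + step n * b x) atTop (𝓝 (a x)) := by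
      simpa using (hσlim.mul_const (a x)).add (tendsto_step.mul_const (b x))
    obtain ⟨n, hn⟩ := (hlim.eventually_le_const hx).exists
    exact ⟨n, hn, hx⟩
  have hTI : ⋂ n, T n = {x | a x ≤ c x} := by
    ext x
    simp only [Set.mem_iInter, T, Set.mem_ofPred_eq]
    refine ⟨fun hx => ?_, fun hx n => (mul_le_of_le_one_left' tsub_le_self).trans hx⟩
    have hlim : Tendsto (fun n => σ n * a x) atTop (𝓝 (a x)) := by
      simpa using hσlim.mul_const (a x)
    exact le_of_tendsto' hlim hx
  have hlimS := tendsto_measure_iUnion_atTop (μ := μ.withDensity fun x => (b x : ℝ≥0∞)) hSmono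
  have hlimT := tendsto_measure_iInter_atTop (μ := μ.withDensity fun x => (a x : ℝ≥0∞))
    (fun n => (hT n).nullMeasurableSet) hTanti
    ⟨0, by
      rw [withDensity_apply _ (hT 0)]
      exact ne_top_of_le_ne_top hfin (setLIntegral_le_lintegral _ _)⟩
  rw [hSU] at hlimS
  rw [hTI] at hlimT
  exact le_of_tendsto_of_tendsto' hlimS hlimT key

lemma HasDensity.convexCombination {μ P Q : Measure Ω} {p q : Ω → ℝ≥0} (hp : HasDensity μ P p)
    (hq : HasDensity μ Q q) (s t : ℝ≥0) :
    HasDensity μ (s • P + t • Q) (fun x => s * p x + t * q x) := by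
  refine ⟨(hp.1.const_mul s).add (hq.1.const_mul t), ?_⟩
  have hp' : Measurable fun x => (p x : ℝ≥0∞) := hp.1.coe_nnreal_ennreal
  have hq' : Measurable fun x => (q x : ℝ≥0∞) := hq.1.coe_nnreal_ennreal
  have e : (fun x => ((s * p x + t * q x : ℝ≥0) : ℝ≥0∞)) =
      ((s : ℝ≥0∞) • fun x => (p x : ℝ≥0∞)) + ((t : ℝ≥0∞) • fun x => (q x : ℝ≥0∞)) := by
    ext x; simp
  rw [e, withDensity_add_left (hp'.const_smul _), withDensity_smul _ hp', withDensity_smul _ hq',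
    ← hp.2, ← hq.2]
  rfl

lemma HasDensity.lintegral_ne_top {μ P : Measure Ω} {p : Ω → ℝ≥0} (hp : HasDensity μ P p)
    [IsFiniteMeasure P] : ∫⁻ x, p x ∂μ ≠ ∞ := by
  have h := measure_ne_top P Set.univ
  rwa [hp.2, withDensity_apply _ MeasurableSet.univ, Measure.restrict_univ] at h

/-- A measure does not charge the zero set of its density. -/
lemma HasDensity.measure_inter_ne_zero {μ P : Measure Ω} {p : Ω → ℝ≥0} (hp : HasDensity μ P p)
    (A : Set Ω) : P (A ∩ {x | p x ≠ 0}) = P A := by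
  refine measure_inter_conull ?_
  have hm : MeasurableSet {x | p x ≠ 0}ᶜ := (hp.1 (measurableSet_singleton 0).compl).compl
  rw [hp.2]
  rw [withDensity_apply _ hm, setLIntegral_eq_zero_iff hm hp.1.coe_nnreal_ennreal]
  exact Eventually.of_forall fun x hx => by simpa using hx

section

variable {μ P₀ P₁ Q₀ Q₁ : Measure Ω} {𝒫₀ 𝒫₁ : Set (Measure Ω)} {p₀ p₁ q₀ q₁ : Ω → ℝ≥0}

lemma MaximizesL.measure_lt_le [IsFiniteMeasure Q₀] (hmax : MaximizesL μ 𝒫₀ 𝒫₁ q₀ q₁)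
    (hconv₀ : Convex ℝ≥0 𝒫₀) (hQ₀ : Q₀ ∈ 𝒫₀) (hQ₁ : Q₁ ∈ 𝒫₁) (hq₀ : HasDensity μ Q₀ q₀)
    (hq₁ : HasDensity μ Q₁ q₁) (hP₀ : P₀ ∈ 𝒫₀) (hp₀ : HasDensity μ P₀ p₀) {η : ℝ≥0}
    (hη : 0 < η) : P₀ {x | η * q₀ x < q₁ x} ≤ Q₀ {x | η * q₀ x ≤ q₁ x} := by
  have h := withDensity_lt_le_withDensity_le (c := fun x => η⁻¹ * q₁ x) hq₀.1 hp₀.1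
    (hq₁.1.const_mul _) hq₀.lintegral_ne_top fun s t hst =>
      hmax η⁻¹ _ (hconv₀ hQ₀ hP₀ zero_le zero_le hst) Q₁ hQ₁ _ q₁
        (hq₀.convexCombination hp₀ s t) hq₁
  rw [← hp₀.2, ← hq₀.2] at h
  simpa only [lt_inv_mul_iff₀ hη, le_inv_mul_iff₀ hη] using h

lemma MaximizesL.measure_gt_le [IsFiniteMeasure Q₁] (hmax : MaximizesL μ 𝒫₀ 𝒫₁ q₀ q₁)
    (hconv₁ : Convex ℝ≥0 𝒫₁) (hQ₀ : Q₀ ∈ 𝒫₀) (hQ₁ : Q₁ ∈ 𝒫₁) (hq₀ : HasDensity μ Q₀ q₀)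
    (hq₁ : HasDensity μ Q₁ q₁) (hP₁ : P₁ ∈ 𝒫₁) (hp₁ : HasDensity μ P₁ p₁) {η : ℝ≥0}
    (hη : 0 < η) : P₁ {x | q₁ x < η * q₀ x} ≤ Q₁ {x | q₁ x ≤ η * q₀ x} := by
  -- Factoring out `λ = 1/η` frees the varying density of its coefficient, so the general lemma
  -- applies with `c = η * q₀`.
  have hL : ∀ r : Ω → ℝ≥0, Measurable r →
      L μ η⁻¹ q₀ r = (η⁻¹ : ℝ≥0) * ∫⁻ x, (min (r x) (η * q₀ x) : ℝ≥0) ∂μ := fun r hr => by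
    rw [← lintegral_const_mul _ (hr.min (hq₀.1.const_mul η)).coe_nnreal_ennreal, L]
    refine lintegral_congr fun x => ?_
    rw [← ENNReal.coe_mul, mul_min_of_nonneg _ _ zero_le, inv_mul_cancel_left₀ hη.ne', min_comm]
  have h := withDensity_lt_le_withDensity_le (c := fun x => η * q₀ x) hq₁.1 hp₁.1
    (hq₀.1.const_mul _) hq₁.lintegral_ne_top fun s t hst => by
      have hd := hq₁.convexCombination hp₁ s t
      have := hmax η⁻¹ Q₀ hQ₀ _ (hconv₁ hQ₁ hP₁ zero_le zero_le hst) q₀ _ hq₀ hd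
      rw [hL _ hd.1, hL _ hq₁.1] at this
      exact (ENNReal.mul_le_mul_iff_right (ENNReal.coe_ne_zero.2 (inv_pos.2 hη).ne')
        ENNReal.coe_ne_top).1 this
  rwa [← hp₁.2, ← hq₁.2] at h

lemma tendsto_add_step_mul (η a : ℝ≥0) :
    Tendsto (fun n => (η + step n) * a) atTop (𝓝 (η * a)) := by
  simpa using (tendsto_step.const_add η).mul_const a

lemma MaximizesL.measure_ratioGT_le [IsFiniteMeasure Q₀] (hmax : MaximizesL μ 𝒫₀ 𝒫₁ q₀ q₁)
    (hconv₀ : Convex ℝ≥0 𝒫₀) (hQ₀ : Q₀ ∈ 𝒫₀) (hQ₁ : Q₁ ∈ 𝒫₁) (hq₀ : HasDensity μ Q₀ q₀)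
    (hq₁ : HasDensity μ Q₁ q₁) (hP₀ : P₀ ∈ 𝒫₀) (hp₀ : HasDensity μ P₀ p₀) (η : ℝ≥0) :
    P₀ (ratioGT q₀ q₁ η) ≤ Q₀ (ratioGT q₀ q₁ η) := by
  have hU : ratioGT q₀ q₁ η = ⋃ n, {x | (η + step n) * q₀ x < q₁ x} := by
    ext x
    simp only [mem_ratioGT, Set.mem_iUnion, Set.mem_ofPred_eq]
    refine ⟨fun hx => ((tendsto_add_step_mul η (q₀ x)).eventually_lt_const hx).exists,
      fun ⟨n, hn⟩ => lt_of_le_of_lt ?_ hn⟩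
    gcongr
    exact le_self_add
  have hmono : Monotone fun n => {x | (η + step n) * q₀ x < q₁ x} := fun m n hmn x hx =>
    lt_of_le_of_lt (mul_le_mul_left (add_le_add_right (antitone_step hmn) η) (q₀ x)) hx
  have hlim := tendsto_measure_iUnion_atTop (μ := P₀) hmono
  rw [← hU] at hlim
  refine le_of_tendsto' hlim fun n => ?_
  have hpos : 0 < η + step n := add_pos_of_nonneg_of_pos zero_le (step_pos n)
  refine (hmax.measure_lt_le hconv₀ hQ₀ hQ₁ hq₀ hq₁ hP₀ hp₀ hpos).trans ?_
  -- Where `q₀ ≠ 0`, a weak inequality at `η + step n` is strict at `η`.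
  rw [← hq₀.measure_inter_ne_zero]
  refine measure_mono fun x hx => mem_ratioGT.2 (lt_of_lt_of_le ?_ hx.1)
  exact mul_lt_mul_of_pos_right (lt_add_of_pos_right η (step_pos n)) (pos_iff_ne_zero.2 hx.2)

lemma MaximizesL.measure_ratioLE_le [IsFiniteMeasure Q₁] (hmax : MaximizesL μ 𝒫₀ 𝒫₁ q₀ q₁)
    (hconv₁ : Convex ℝ≥0 𝒫₁) (hQ₀ : Q₀ ∈ 𝒫₀) (hQ₁ : Q₁ ∈ 𝒫₁) (hq₀ : HasDensity μ Q₀ q₀)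
    (hq₁ : HasDensity μ Q₁ q₁) (hP₁ : P₁ ∈ 𝒫₁) (hp₁ : HasDensity μ P₁ p₁) (η : ℝ≥0) :
    P₁ (ratioLE q₀ q₁ η) ≤ Q₁ (ratioLE q₀ q₁ η) := by
  set T : ℕ → Set Ω := fun n => {x | q₁ x ≤ (η + step n) * q₀ x}
  have hT : ∀ n, MeasurableSet (T n) := fun n => measurableSet_le hq₁.1 (hq₀.1.const_mul _)
  have hanti : Antitone T := fun m n hmn x hx =>
    le_trans hx (mul_le_mul_left (add_le_add_right (antitone_step hmn) η) (q₀ x))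
  have hlim := tendsto_measure_iInter_atTop (μ := Q₁) (fun n => (hT n).nullMeasurableSet) hanti
    ⟨0, measure_ne_top _ _⟩
  have hle : ∀ n, P₁ (ratioLE q₀ q₁ η) ≤ Q₁ (T n) := fun n => by
    have hpos : 0 < η + step n := add_pos_of_nonneg_of_pos zero_le (step_pos n)
    refine le_trans (measure_mono fun x hx => ?_)
      (hmax.measure_gt_le hconv₁ hQ₀ hQ₁ hq₀ hq₁ hP₁ hp₁ hpos)
    obtain ⟨h0, h1⟩ := mem_ratioLE.1 hx
    exact h1.trans_lt
      (mul_lt_mul_of_pos_right (lt_add_of_pos_right η (step_pos n)) (pos_iff_ne_zero.2 h0))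
  refine (ge_of_tendsto' hlim hle).trans ?_
  -- The limit set contains the 0/0 points, which `ratioLE` excludes; `Q₁` does not charge them.
  rw [← hq₁.measure_inter_ne_zero]
  refine measure_mono fun x hx => ?_
  have h1 : q₁ x ≤ η * q₀ x :=
    ge_of_tendsto' (tendsto_add_step_mul η (q₀ x)) (Set.mem_iInter.1 hx.1)
  refine mem_ratioLE.2 ⟨fun h0 => hx.2 ?_, h1⟩
  simpa [h0] using h1

end

end RobustTest

theorem theorem3 {Ω : Type*} [MeasurableSpace Ω] (μ : Measure Ω)
    (𝒫₀ 𝒫₁ : Set (Measure Ω))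
    (h𝒫₀ : 𝒫₀ ⊆ RobustTest.DominatedDistributions μ)
    (h𝒫₁ : 𝒫₁ ⊆ RobustTest.DominatedDistributions μ)
    (hconv₀ : Convex ℝ≥0 𝒫₀) (hconv₁ : Convex ℝ≥0 𝒫₁)
    (Q₀ Q₁ : Measure Ω) (hQ₀ : Q₀ ∈ 𝒫₀) (hQ₁ : Q₁ ∈ 𝒫₁)
    (q₀ q₁ : Ω → ℝ≥0)
    (hq₀ : RobustTest.HasDensity μ Q₀ q₀) (hq₁ : RobustTest.HasDensity μ Q₁ q₁)
    (hmax : RobustTest.MaximizesL μ 𝒫₀ 𝒫₁ q₀ q₁) :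
    RobustTest.StochasticallyLeastFavorable 𝒫₀ 𝒫₁ Q₀ Q₁ q₀ q₁ := by
  intro P₀ hP₀ P₁ hP₁ η
  obtain ⟨-, p₀, hp₀⟩ := h𝒫₀ hP₀
  obtain ⟨-, p₁, hp₁⟩ := h𝒫₁ hP₁
  have : IsProbabilityMeasure Q₀ := (h𝒫₀ hQ₀).1
  have : IsProbabilityMeasure Q₁ := (h𝒫₁ hQ₁).1
  exact ⟨hmax.measure_ratioGT_le hconv₀ hQ₀ hQ₁ hq₀ hq₁ hP₀ hp₀ η,
    hmax.measure_ratioLE_le hconv₁ hQ₀ hQ₁ hq₀ hq₁ hP₁ hp₁ η⟩
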